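/- **Lemma 5.4 (approximately isotropic $k$-DPP after a randomized Hadamard transform).** Let $m=2^{\ell}$ with $\ell\ge 0$, and let $\mathbf H=\mathbf H_m\in\mathbb R^{m\times m}$ be the Hadamard matrix given by $\mathbf H_1=[1]$ and $\mathbf H_{2p}=\begin{bmatrix}\mathbf H_p&\mathbf H_p\\ \mathbf H_p&-\mathbf H_p\end{bmatrix}$. Let $\mathbf A\in\mathbb R^{m\times n}$, let $k$ be an integer with $0\le k\le \mathrm{rank}(\mathbf A)$, let $\mathbf D$ be the random $m\times m$ diagonal matrix whose diagonal entries are independent random signs, each equal to $\pm1$ with probability $1/2$, and put $\bar{\mathbf A}=\frac1{\sqrt m}\mathbf H\mathbf D\mathbf A$. For a positive semidefinite $\mathbf L\in\mathbb R^{m\times m}$ with $\mathrm{rank}(\mathbf L)\ge k$, let $k\text{-}\mathrm{DPP}(\mathbf L)$ be the probability distribution on the $k$-element subsets $S$ of $[m]=\{1,\dots,m\}$ with $\Pr\{S\}=\det(\mathbf L_{S,S})\big/\sum_{|T|=k}\det(\mathbf L_{T,T})$, where $\mathbf L_{S,S}$ is the principal submatrix indexed by $S$. Almost surely over $\mathbf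 D$, the distribution $k\text{-}\mathrm{DPP}(\bar{\mathbf A}\bar{\mathbf A}^\top)$ is well defined. Let $S_{\mathrm{DPP}}\sim k\text{-}\mathrm{DPP}(\bar{\mathbf A}\bar{\mathbf A}^\top)$ given $\mathbf D$, and let $\Pr\{j\in S_{\mathrm{DPP}}\}$ denote its marginals for fixed $\mathbf D$. For every $0<\delta<1$, with probability at least $1-\delta$ over $\mathbf D$, $$\Pr\{j\in S_{\mathrm{DPP}}\}\le\left(\sqrt{\frac km}+\sqrt{\frac{8\log(m/\delta)}{m}}\right)^2\qquad\text{for all } j\in[m].$$ The marginals are therefore approximately isotropic: there is an absolute constant $c_0>0$ (independent of $m,n,k,\mathbf A$) such that, if moreover $k\ge\log m$, then with probability at least $0.99$ over $\mathbf D$, $\Pr\{j\in S_{\mathrm{DPP}}\}\le c_0k/m$ for all $j\in[m]$. -/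

import Mathlib

open MeasureTheory ProbabilityTheory

noncomputable section

/-- The Hadamard matrix of size `2 ^ l` (Sylvester's recursion): `H₁ = [1]` and
`H₂ₙ = [[Hₙ, Hₙ], [Hₙ, -Hₙ]]`, where the first block of rows and columns carries the indices
`0, …, n - 1` and the second block the indices `n, …, 2 n - 1`. -/
def hadamardMatrix : (l : ℕ) → Matrix (Fin (2 ^ l)) (Fin (2 ^ l)) ℝ
  | 0 => Matrix.of fun _ _ => 1
  | l + 1 =>
    let e : Fin (2 ^ l) ⊕ Fin (2 ^ l) ≃ Fin (2 ^ (l + 1)) :=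
      finSumFinEquiv.trans (finCongr (by rw [pow_succ, mul_two]))
    Matrix.reindex e e
      (Matrix.fromBlocks (hadamardMatrix l) (hadamardMatrix l)
        (hadamardMatrix l) (-hadamardMatrix l))

/-- The matrix `m^{-1/2} H D A` with `m = 2 ^ l` and `D` the diagonal matrix with diagonal `d`. -/
def hadamardTransform {l n : ℕ} (d : Fin (2 ^ l) → ℝ) (A : Matrix (Fin (2 ^ l)) (Fin n) ℝ) :
    Matrix (Fin (2 ^ l)) (Fin n) ℝ :=
  (1 / √((2 : ℝ) ^ l)) • (hadamardMatrix l * Matrix.diagonal d * A)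

/-- `d` is a Rademacher vector under `P`: its coordinates are independent random signs, each equal
to `1` with probability `1/2` and to `-1` with probability `1/2`. -/
structure IsRademacherVector {Ω ι : Type*} [MeasurableSpace Ω] (P : Measure Ω)
    (d : ι → Ω → ℝ) : Prop where
  measurable : ∀ i, Measurable (d i)
  indep : iIndepFun d P
  prob_one : ∀ i, P.real {ω | d i ω = 1} = 1 / 2
  prob_neg_one : ∀ i, P.real {ω | d i ω = -1} = 1 / 2

/-- The unnormalized `k`-DPP weight of a subset `S`: the principal minor `det L_{S,S}`
if `|S| = k`, and `0` otherwise. -/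
def kDPPWeight {m : ℕ} (k : ℕ) (L : Matrix (Fin m) (Fin m) ℝ) (S : Finset (Fin m)) : ℝ :=
  if S.card = k then (L.submatrix (fun i : S => (i : Fin m)) (fun i : S => (i : Fin m))).det
  else 0

/-- `k`-DPP`(L)` for a positive semidefinite matrix `L`, as the law of a random subset: it gives
each `S` the mass `det L_{S,S} / ∑_{|T| = k} det L_{T,T}` if `|S| = k` and the mass `0` otherwise.
It is a probability measure as soon as some principal minor of size `k` is nonzero. -/
def kDPP {m : ℕ} (k : ℕ) (L : Matrix (Fin m) (Fin m) ℝ) : Measure (Finset (Fin m)) :=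
  ∑ S : Finset (Fin m),
    ENNReal.ofReal (kDPPWeight k L S / ∑ T : Finset (Fin m), kDPPWeight k L T) •
      Measure.dirac S

/-- The marginal probability `Pr {j ∈ S}` for `S` distributed as `k`-DPP`(Ā Āᵀ)`, where
`Ā = m^{-1/2} H D A` and the diagonal `d` of `D` is held fixed. -/
def marginalAfterTransform {l n : ℕ} (k : ℕ) (A : Matrix (Fin (2 ^ l)) (Fin n) ℝ)
    (d : Fin (2 ^ l) → ℝ) (j : Fin (2 ^ l)) : ℝ :=
  (kDPP k (hadamardTransform d A * (hadamardTransform d A).transpose)).real {S | j ∈ S}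

end

/-! Write `A Aᵀ = V diag(v) Vᵀ`. For signs `d`, the matrix `Q = m^{-1/2} H D` is orthogonal, so the
transformed ensemble keeps the eigenvalues `v` and has eigenvectors `Q V`. The marginal at `j` of a
`k`-DPP is `∑ i, w i * (Q V) j i ^ 2`, where the weights `w i ∈ [0, 1]` depend only on `v` and sum
to `k` (`kDPP_real_mem`, proved by comparing coefficients of an adjugate).

As the entries of `H` are `±1`, the vectors `a ↦ H j a * V a i` are orthonormal in `i`. Hence `m`
times the marginal is the squared norm of a contraction of squared Frobenius norm `k`, applied to a
sign vector. Its square root exceeds `√k + t` with probability at most `exp (-t² / 2)`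
(`measure_quadratic_gt_le`): Gaussian linearization bounds the exponential moment, and a Chernoff
bound follows. A union bound over `j` concludes. -/

/-! ### Principal minors under orthogonal conjugation. -/

section PrincipalMinors

open Matrix Polynomial

variable {ι R : Type*} [Fintype ι] [DecidableEq ι] [CommRing R]

/-- The diagonal entries of the adjugate of `1 + X M` generate the principal minors of `M`
avoiding a given index. -/
lemma coeff_adjugate_one_add_X_smul (M : Matrix ι ι R) (k : ℕ) (j : ι) :
    ((1 + (X : R[X]) • M.map C).adjugate j j).coeff k =
      ∑ S ∈ Finset.univ.powersetCard k with j ∉ S,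
        (M.submatrix (Subtype.val : S → ι) (Subtype.val : S → ι)).det := by
  -- Replacing row `j` by `e_j` amounts to zeroing row `j` of `M`, which kills exactly the minors
  -- containing `j`.
  have hrow : (1 + (X : R[X]) • M.map C).updateRow j (Pi.single j 1) =
      1 + (X : R[X]) • (M.updateRow j 0).map C := by
    ext a b : 2
    by_cases ha : a = j
    · subst ha
      simp [Matrix.one_apply, Pi.single_apply, eq_comm]
    · simp [ha]
  rw [adjugate_apply, hrow, coeff_det_one_add_X_smul_eq_sum_minors, Finset.sum_filter]
  refine Finset.sum_congr rfl fun S _ => ?_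
  by_cases h : j ∈ S
  · rw [if_neg (not_not.mpr h)]
    exact det_eq_zero_of_row_eq_zero ⟨j, h⟩ fun b => by simp
  · rw [if_pos h]
    congr 1
    ext a b
    have : (a : ι) ≠ j := fun e => h (e ▸ a.2)
    simp [this]

omit [Fintype ι] in
lemma det_submatrix_diagonal (v : ι → R) (S : Finset ι) :
    ((diagonal v).submatrix (Subtype.val : S → ι) (Subtype.val : S → ι)).det = ∏ i ∈ S, v i := by
  rw [submatrix_diagonal _ _ Subtype.val_injective, det_diagonal]
  exact Finset.prod_coe_sort S v

lemma one_add_X_smul_conj {U V : Matrix ι ι R} (hUV : U * V = 1) (M : Matrix ι ι R) :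
    1 + (X : R[X]) • (U * M * V).map C =
      U.map C * (1 + (X : R[X]) • M.map C) * V.map C := by
  have h : (U.map C * V.map C : Matrix ι ι R[X]) = 1 := by
    rw [← Matrix.map_mul, hUV]; simp
  rw [mul_add, add_mul, mul_one, h, Matrix.map_mul, Matrix.map_mul]
  simp

lemma sum_principal_minors_conj_diagonal {U V : Matrix ι ι R} (hUV : U * V = 1) (v : ι → R)
    (k : ℕ) :
    ∑ S ∈ Finset.univ.powersetCard k,
        ((U * diagonal v * V).submatrix (Subtype.val : S → ι) (Subtype.val : S → ι)).det =
      ∑ T ∈ Finset.univ.powersetCard k, ∏ i ∈ T, v i := by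
  have h : (U.map C).det * (V.map C : Matrix ι ι R[X]).det = 1 := by
    rw [← det_mul, ← Matrix.map_mul, hUV]; simp
  rw [← coeff_det_one_add_X_smul_eq_sum_minors, one_add_X_smul_conj hUV, det_mul, det_mul,
    mul_right_comm, h, one_mul, coeff_det_one_add_X_smul_eq_sum_minors]
  simp_rw [det_submatrix_diagonal]

/-- The adjugate of `1 + X M` is conjugated by `U` along with `M`. For diagonal `M` it is diagonal,
so its `(j, j)` entry becomes an average with weights `U j i ^ 2`. Working over polynomials avoids
inverting `M`. -/
lemma sum_principal_minors_conj_diagonal_of_notMem {U : Matrix ι ι R} (hU : U * Uᵀ = 1)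
    (v : ι → R) (k : ℕ) (j : ι) :
    ∑ S ∈ Finset.univ.powersetCard k with j ∉ S,
        ((U * diagonal v * Uᵀ).submatrix (Subtype.val : S → ι) (Subtype.val : S → ι)).det =
      ∑ i, U j i ^ 2 * ∑ T ∈ Finset.univ.powersetCard k with i ∉ T, ∏ a ∈ T, v a := by
  have hU' : Uᵀ * U = 1 := mul_eq_one_comm.mp hU
  have hadj : ∀ {A B : Matrix ι ι R}, A * B = 1 →
      (A.map C : Matrix ι ι R[X]).adjugate = (A.map C).det • B.map C := by
    intro A B hAB
    have h : (A.map C : Matrix ι ι R[X]) * B.map C = 1 := by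
      rw [← Matrix.map_mul, hAB]; simp
    calc _ = (A.map C).adjugate * (A.map C * B.map C) := by rw [h, mul_one]
      _ = _ := by rw [← mul_assoc, adjugate_mul, smul_mul_assoc, one_mul]
  have hdet : (U.map C).det * (Uᵀ.map C : Matrix ι ι R[X]).det = 1 := by
    rw [← det_mul, ← Matrix.map_mul, hU]; simp
  set D : Matrix ι ι R[X] := 1 + (X : R[X]) • (diagonal v).map C with hD
  have hDd : D = diagonal fun i => 1 + X * C (v i) := by
    ext a b : 2
    by_cases h : a = b
    · subst h; simp [hD]
    · simp [hD, h]
  have key : (1 + (X : R[X]) • (U * diagonal v * Uᵀ).map C).adjugate =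
      U.map C * D.adjugate * Uᵀ.map C := by
    rw [one_add_X_smul_conj hU, adjugate_mul_distrib, adjugate_mul_distrib, hadj hU, hadj hU']
    simp only [smul_mul_assoc, mul_smul_comm, smul_smul, hdet, one_smul, mul_assoc, hD]
  rw [← coeff_adjugate_one_add_X_smul, key]
  have : (U.map C * D.adjugate * Uᵀ.map C) j j = ∑ i, C (U j i ^ 2) * D.adjugate i i := by
    rw [hDd, adjugate_diagonal]
    rw [mul_apply]
    simp only [mul_diagonal, diagonal_apply_eq, map_apply, transpose_apply]
    refine Finset.sum_congr rfl fun i _ => ?_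
    rw [C_pow]; ring
  rw [this, finsetSum_coeff]
  refine Finset.sum_congr rfl fun i _ => ?_
  rw [coeff_C_mul, hD, coeff_adjugate_one_add_X_smul]
  simp_rw [det_submatrix_diagonal]

end PrincipalMinors

/-! ### Exponential moments and tails of quadratic forms in random signs. -/

section RademacherQuadraticForm

open Real

lemma integral_gaussianReal_exp_mul_sq {a : ℝ} (ha : a < 1) :
    ∫ x, exp (a / 2 * x ^ 2) ∂(gaussianReal 0 1) = √(1 / (1 - a)) := by
  rw [integral_gaussianReal_eq_integral_smul one_ne_zero]
  have h : ∀ x : ℝ, gaussianPDFReal 0 1 x • exp (a / 2 * x ^ 2) =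
      (√(2 * π))⁻¹ * exp (-((1 - a) / 2) * x ^ 2) := by
    intro x
    simp only [gaussianPDFReal, NNReal.coe_one, mul_one, sub_zero, smul_eq_mul]
    rw [mul_assoc, ← exp_add]
    congr 2
    ring
  simp_rw [h]
  have h1 : 0 < 1 - a := by linarith
  rw [integral_const_mul, integral_gaussian, ← sqrt_inv, ← sqrt_mul (by positivity)]
  congr 1
  field_simp

lemma integrable_gaussianReal_exp_mul_sq {a : ℝ} (ha : a < 1) :
    Integrable (fun x => exp (a / 2 * x ^ 2)) (gaussianReal 0 1) := by
  -- A non-integrable function would have integral `0`, but the computed value is positive.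
  by_contra h
  have h0 := integral_undef h
  rw [integral_gaussianReal_exp_mul_sq ha] at h0
  have h1 : 0 < 1 - a := by linarith
  exact (sqrt_pos.mpr (by positivity : 0 < 1 / (1 - a))).ne' h0

variable {Ω α ι : Type*} [MeasurableSpace Ω] [Fintype α] [Fintype ι] {P : Measure Ω}

lemma lintegral_pi_gaussianReal_exp_linear (c : ι → ℝ) :
    ∫⁻ g, ENNReal.ofReal (exp (∑ i, c i * g i)) ∂(Measure.pi fun _ : ι => gaussianReal 0 1) =
      ENNReal.ofReal (exp (∑ i, c i ^ 2 / 2)) := by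
  have hint : Integrable (fun g : ι → ℝ => ∏ i, exp (c i * g i))
      (Measure.pi fun _ : ι => gaussianReal 0 1) :=
    Integrable.fintype_prod (f := fun i x => exp (c i * x)) fun i =>
      integrable_exp_mul_gaussianReal (c i)
  simp_rw [exp_sum]
  rw [← ofReal_integral_eq_lintegral_ofReal hint
    (Filter.Eventually.of_forall fun g => Finset.prod_nonneg fun _ _ => (exp_pos _).le),
    integral_fintype_prod_eq_prod (fun i x => exp (c i * x))]
  congr 1
  refine Finset.prod_congr rfl fun i _ => ?_
  have := congrFun (mgf_id_gaussianReal (μ := 0) (v := 1)) (c i)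
  simpa [mgf] using this

lemma lintegral_pi_gaussianReal_exp_sq (a : ι → ℝ) (ha : ∀ i, a i < 1) :
    ∫⁻ g, ENNReal.ofReal (exp (∑ i, a i / 2 * g i ^ 2))
        ∂(Measure.pi fun _ : ι => gaussianReal 0 1) =
      ENNReal.ofReal (∏ i, √(1 / (1 - a i))) := by
  have hint : Integrable (fun g : ι → ℝ => ∏ i, exp (a i / 2 * g i ^ 2))
      (Measure.pi fun _ : ι => gaussianReal 0 1) :=
    Integrable.fintype_prod (f := fun i x => exp (a i / 2 * x ^ 2)) fun i =>
      integrable_gaussianReal_exp_mul_sq (ha i)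
  simp_rw [exp_sum]
  rw [← ofReal_integral_eq_lintegral_ofReal hint
    (Filter.Eventually.of_forall fun g => Finset.prod_nonneg fun _ _ => (exp_pos _).le),
    integral_fintype_prod_eq_prod (fun i x => exp (a i / 2 * x ^ 2))]
  simp_rw [fun i => integral_gaussianReal_exp_mul_sq (ha i)]

variable [IsProbabilityMeasure P] {d : α → Ω → ℝ}

lemma IsRademacherVector.ae_eq_one_or (hd : IsRademacherVector P d) :
    ∀ᵐ ω ∂P, ∀ a, d a ω = 1 ∨ d a ω = -1 := by
  rw [ae_all_iff]
  intro a
  have h1 : MeasurableSet {ω | d a ω = 1} := hd.measurable a (measurableSet_singleton 1)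
  have h2 : MeasurableSet {ω | d a ω = -1} := hd.measurable a (measurableSet_singleton (-1))
  have hdisj : Disjoint {ω | d a ω = 1} {ω | d a ω = -1} := by
    rw [Set.disjoint_left]
    intro ω (h : d a ω = 1) (h' : d a ω = -1)
    linarith
  have hu : P.real ({ω | d a ω = 1} ∪ {ω | d a ω = -1}) = 1 := by
    rw [measureReal_union hdisj h2, hd.prob_one, hd.prob_neg_one]; norm_num
  have hu' : P ({ω | d a ω = 1} ∪ {ω | d a ω = -1}) = 1 := by
    rw [measureReal_def, ENNReal.toReal_eq_one_iff] at hu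
    exact hu
  exact (prob_compl_eq_zero_iff (h1.union h2)).mpr hu'

lemma IsRademacherVector.integral_eq_zero (hd : IsRademacherVector P d) (a : α) :
    ∫ ω, d a ω ∂P = 0 := by
  have h1 : MeasurableSet {ω | d a ω = 1} := hd.measurable a (measurableSet_singleton 1)
  have h2 : MeasurableSet {ω | d a ω = -1} := hd.measurable a (measurableSet_singleton (-1))
  have h : d a =ᵐ[P] fun ω => {ω | d a ω = 1}.indicator (fun _ => (1 : ℝ)) ω
      - {ω | d a ω = -1}.indicator (fun _ => (1 : ℝ)) ω := by
    filter_upwards [hd.ae_eq_one_or] with ω hω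
    rcases hω a with h | h <;> norm_num [Set.indicator_apply, h]
  rw [integral_congr_ae h, integral_sub ((integrable_const _).indicator h1)
    ((integrable_const _).indicator h2), integral_indicator_const _ h1,
    integral_indicator_const _ h2, hd.prob_one, hd.prob_neg_one, sub_self]

lemma IsRademacherVector.hasSubgaussianMGF (hd : IsRademacherVector P d) (a : α) :
    HasSubgaussianMGF (d a) 1 P := by
  have h := hasSubgaussianMGF_of_mem_Icc_of_integral_eq_zero (μ := P) (X := d a) (a := -1) (b := 1)
    (hd.measurable a).aemeasurable
    (by
      filter_upwards [hd.ae_eq_one_or] with ω hω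
      rcases hω a with h | h <;> norm_num [h]) (hd.integral_eq_zero a)
  convert h using 1
  -- Hoeffding's variance proxy for `[-1, 1]` is `(2 / 2)² = 1`.
  rw [show (1 : ℝ) - -1 = 2 by norm_num]
  simp

lemma IsRademacherVector.lintegral_exp_linear_le (hd : IsRademacherVector P d) (c : α → ℝ) :
    ∫⁻ ω, ENNReal.ofReal (exp (∑ a, c a * d a ω)) ∂P ≤
      ENNReal.ofReal (exp ((∑ a, c a ^ 2) / 2)) := by
  have hi : iIndepFun (fun a ω => c a * d a ω) P :=
    hd.indep.comp (fun a x => c a * x) fun a => measurable_const_mul (c a)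
  have h := HasSubgaussianMGF.sum_of_iIndepFun (s := Finset.univ) hi
    fun a _ => (hd.hasSubgaussianMGF a).const_mul (c a)
  have hint := h.integrable_exp_mul 1
  have hle := h.mgf_le 1
  simp only [mgf, one_mul] at hint hle
  rw [← ofReal_integral_eq_lintegral_ofReal hint
    (Filter.Eventually.of_forall fun _ => (exp_pos _).le)]
  refine ENNReal.ofReal_le_ofReal (hle.trans (le_of_eq ?_))
  congr 2
  rw [one_pow, mul_one, NNReal.coe_sum]
  refine Finset.sum_congr rfl fun a _ => ?_
  exact mul_one _

variable {v : ι → α → ℝ} {w : ι → ℝ}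

/-- Comparison of the Laplace transform of a quadratic form in random signs with the one of the
same quadratic form in Gaussian variables. -/
lemma IsRademacherVector.lintegral_exp_quadratic_le [DecidableEq ι] (hd : IsRademacherVector P d)
    (hv : ∀ i i', ∑ a, v i a * v i' a = if i = i' then 1 else 0) (hw0 : ∀ i, 0 ≤ w i)
    (hw1 : ∀ i, w i < 1) :
    ∫⁻ ω, ENNReal.ofReal (exp (∑ i, w i * (∑ a, v i a * d a ω) ^ 2 / 2)) ∂P ≤
      ENNReal.ofReal (∏ i, √(1 / (1 - w i))) := by
  set γ : Measure (ι → ℝ) := Measure.pi fun _ : ι => gaussianReal 0 1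
  have hm := hd.measurable
  calc _ = ∫⁻ ω, ∫⁻ g, ENNReal.ofReal
          (exp (∑ i, √(w i) * (∑ a, v i a * d a ω) * g i)) ∂γ ∂P := by
        -- Linearization: `exp (w y² / 2)` is the Gaussian average of `exp (√w y g)`. The signs then
        -- enter linearly and can be integrated first.
        refine lintegral_congr fun ω => ?_
        rw [lintegral_pi_gaussianReal_exp_linear]
        simp_rw [mul_pow, fun i => sq_sqrt (hw0 i)]
    _ = ∫⁻ g, ∫⁻ ω, ENNReal.ofReal
          (exp (∑ i, √(w i) * (∑ a, v i a * d a ω) * g i)) ∂P ∂γ :=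
        lintegral_lintegral_swap (by
          refine Measurable.aemeasurable ?_
          unfold Function.uncurry
          fun_prop)
    _ = ∫⁻ g, ∫⁻ ω, ENNReal.ofReal
          (exp (∑ a, (∑ i, √(w i) * v i a * g i) * d a ω)) ∂P ∂γ := by
        refine lintegral_congr fun g => lintegral_congr fun ω => ?_
        congr 2
        simp_rw [Finset.mul_sum, Finset.sum_mul]
        rw [Finset.sum_comm]
        exact Finset.sum_congr rfl fun a _ => Finset.sum_congr rfl fun i _ => by ring
    _ ≤ ∫⁻ g, ENNReal.ofReal (exp ((∑ a, (∑ i, √(w i) * v i a * g i) ^ 2) / 2)) ∂γ :=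
        lintegral_mono fun g => hd.lintegral_exp_linear_le _
    _ = ∫⁻ g, ENNReal.ofReal (exp (∑ i, w i / 2 * g i ^ 2)) ∂γ := by
        refine lintegral_congr fun g => ?_
        congr 2
        have : ∑ a, (∑ i, √(w i) * v i a * g i) ^ 2 = ∑ i, w i * g i ^ 2 := by
          calc _ = ∑ a, ∑ i, ∑ i', (√(w i) * g i) * (√(w i') * g i') * (v i a * v i' a) := by
                refine Finset.sum_congr rfl fun a _ => ?_
                rw [sq, Finset.sum_mul_sum]
                exact Finset.sum_congr rfl fun i _ => Finset.sum_congr rfl fun i' _ => by ring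
            _ = ∑ i, ∑ i', (√(w i) * g i) * (√(w i') * g i') * ∑ a, v i a * v i' a := by
                rw [Finset.sum_comm]
                refine Finset.sum_congr rfl fun i _ => ?_
                rw [Finset.sum_comm]
                simp_rw [Finset.mul_sum]
            _ = _ := by
                refine Finset.sum_congr rfl fun i _ => ?_
                simp only [hv, mul_ite, mul_one, mul_zero, Finset.sum_ite_eq, Finset.mem_univ,
                  if_true]
                nlinarith [sq_sqrt (hw0 i)]
        rw [this, Finset.sum_div]
        exact Finset.sum_congr rfl fun i _ => by ring
    _ = _ := lintegral_pi_gaussianReal_exp_sq w hw1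

/-- Bernoulli's inequality `(1 - s) ^ w ≤ 1 - s w` makes the product over the weights depend only on
their sum. -/
lemma sqrt_one_div_le_exp {s w : ℝ} (hs1 : s < 1) (hw0 : 0 ≤ w) (hw1 : w ≤ 1) :
    √(1 / (1 - s * w)) ≤ exp (-log (1 - s) / 2 * w) := by
  have h1 : 0 < 1 - s := by linarith
  have hb : (1 + -s) ^ w ≤ 1 + w * -s := rpow_one_add_le_one_add_mul_self (by linarith) hw0 hw1
  rw [← sub_eq_add_neg, rpow_def_of_pos h1] at hb
  rw [sqrt_le_left (exp_pos _).le, ← exp_nat_mul]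
  calc 1 / (1 - s * w) ≤ 1 / exp (log (1 - s) * w) :=
        one_div_le_one_div_of_le (exp_pos _) (hb.trans (le_of_eq (by ring)))
    _ = _ := by
        rw [one_div, ← exp_neg]
        congr 1
        push_cast
        ring

/-- Tail bound for the Euclidean norm of a contraction applied to a vector of random signs. -/
lemma IsRademacherVector.measure_quadratic_gt_le [DecidableEq ι] (hd : IsRademacherVector P d)
    (hv : ∀ i i', ∑ a, v i a * v i' a = if i = i' then 1 else 0) (hw0 : ∀ i, 0 ≤ w i)
    (hw1 : ∀ i, w i ≤ 1) {t : ℝ} (ht : 0 ≤ t) :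
    P {ω | (√(∑ i, w i) + t) ^ 2 < ∑ i, w i * (∑ a, v i a * d a ω) ^ 2} ≤
      ENNReal.ofReal (exp (-t ^ 2 / 2)) := by
  set κ := ∑ i, w i with hκ
  have hκ0 : 0 ≤ κ := Finset.sum_nonneg fun i _ => hw0 i
  rcases hκ0.eq_or_lt with h0 | hpos
  · have hz : ∀ i, w i = 0 := fun i =>
      (Finset.sum_eq_zero_iff_of_nonneg fun i _ => hw0 i).mp h0.symm i (Finset.mem_univ i)
    have : {ω | (√κ + t) ^ 2 < ∑ i, w i * (∑ a, v i a * d a ω) ^ 2} = ∅ := by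
      ext ω
      simpa [hz] using sq_nonneg _
    rw [this]
    simp
  set r := √κ with hr
  have hr0 : 0 < r := sqrt_pos.mpr hpos
  have hr2 : r ^ 2 = κ := sq_sqrt hκ0
  -- This minimizes the Chernoff exponent `-κ log (1 - s) / 2 - s (r + t)² / 2`; `κ > 0` ensures `s
  -- < 1`.
  set s := 1 - κ / (r + t) ^ 2 with hs
  have hu : 0 < (r + t) ^ 2 := by positivity
  have hs1 : s < 1 := by
    have : 0 < κ / (r + t) ^ 2 := by positivity
    linarith
  have hs0 : 0 ≤ s := by
    rw [hs, sub_nonneg, div_le_one hu, ← hr2]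
    exact pow_le_pow_left₀ hr0.le (by linarith) 2
  have hmgf : ∫⁻ ω, ENNReal.ofReal (exp (∑ i, s * w i * (∑ a, v i a * d a ω) ^ 2 / 2)) ∂P ≤
      ENNReal.ofReal (exp (-log (1 - s) / 2 * κ)) := by
    refine (hd.lintegral_exp_quadratic_le hv (fun i => mul_nonneg hs0 (hw0 i))
      fun i => ?_).trans (ENNReal.ofReal_le_ofReal ?_)
    · nlinarith [hw0 i, hw1 i]
    · rw [hκ, Finset.mul_sum, exp_sum]
      exact Finset.prod_le_prod (fun _ _ => sqrt_nonneg _) fun i _ =>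
        sqrt_one_div_le_exp hs1 (hw0 i) (hw1 i)
  have hm := hd.measurable
  have hmarkov := meas_ge_le_lintegral_div (μ := P)
    (f := fun ω => ENNReal.ofReal (exp (∑ i, s * w i * (∑ a, v i a * d a ω) ^ 2 / 2)))
    (by fun_prop) (ε := ENNReal.ofReal (exp (s * (r + t) ^ 2 / 2)))
    (by simpa using exp_pos _) ENNReal.ofReal_ne_top
  refine (measure_mono fun ω hω => ?_).trans (hmarkov.trans ((ENNReal.div_le_div_right hmgf _).trans
    ?_))
  · refine ENNReal.ofReal_le_ofReal (exp_le_exp.mpr ?_)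
    have : ∑ i, s * w i * (∑ a, v i a * d a ω) ^ 2 / 2 =
        s * (∑ i, w i * (∑ a, v i a * d a ω) ^ 2) / 2 := by
      rw [Finset.mul_sum, Finset.sum_div]
      exact Finset.sum_congr rfl fun i _ => by ring
    rw [this]
    have := mul_le_mul_of_nonneg_left (le_of_lt hω) hs0
    linarith
  · rw [← ENNReal.ofReal_div_of_pos (exp_pos _), ← exp_sub]
    refine ENNReal.ofReal_le_ofReal (exp_le_exp.mpr ?_)
    have hsu : s * (r + t) ^ 2 = (r + t) ^ 2 - r ^ 2 := by
      rw [hs, sub_mul, one_mul, div_mul_cancel₀ _ hu.ne', hr2]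
    -- From `log (1 + t / r) ≤ t / r`, the exponent is at most `t r - ((r + t)² - r²) / 2 = -t² /
    -- 2`.
    have hlog : -log (1 - s) ≤ 2 * (t / r) := by
      have : 1 - s = ((1 + t / r) ^ 2)⁻¹ := by
        rw [hs, ← hr2]
        field_simp
        ring
      rw [this, log_inv, neg_neg, log_pow]
      have := log_le_sub_one_of_pos (show 0 < 1 + t / r by positivity)
      push_cast
      linarith
    have hlog' : -log (1 - s) * κ ≤ 2 * (t * r) := by
      refine (mul_le_mul_of_nonneg_right hlog hκ0).trans (le_of_eq ?_)
      rw [← hr2]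
      field_simp
    rw [hsu]
    nlinarith

end RademacherQuadraticForm

/-! ### Inclusion probabilities of eigenvectors. -/

section EigenvectorInclusion

variable {ι : Type*} [Fintype ι] [DecidableEq ι]

/-- The probability that the eigenvector with index `i` is selected in the representation of a
`k`-DPP with eigenvalues `v` as a mixture of projection DPPs. -/
noncomputable def eigenInclusionProb (k : ℕ) (v : ι → ℝ) (i : ι) : ℝ :=
  (∑ T ∈ Finset.univ.powersetCard k with i ∈ T, ∏ a ∈ T, v a) /
    ∑ T ∈ Finset.univ.powersetCard k, ∏ a ∈ T, v a

variable {k : ℕ} {v : ι → ℝ}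

lemma eigenInclusionProb_nonneg (hv : ∀ i, 0 ≤ v i) (i : ι) : 0 ≤ eigenInclusionProb k v i :=
  div_nonneg (Finset.sum_nonneg fun _ _ => Finset.prod_nonneg fun a _ => hv a)
    (Finset.sum_nonneg fun _ _ => Finset.prod_nonneg fun a _ => hv a)

lemma eigenInclusionProb_le_one (hv : ∀ i, 0 ≤ v i) (i : ι) : eigenInclusionProb k v i ≤ 1 :=
  div_le_one_of_le₀
    (Finset.sum_le_sum_of_subset_of_nonneg (Finset.filter_subset _ _)
      fun _ _ _ => Finset.prod_nonneg fun a _ => hv a)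
    (Finset.sum_nonneg fun _ _ => Finset.prod_nonneg fun a _ => hv a)

/-- Double counting: each `k`-subset is counted once for each of its `k` elements. -/
lemma sum_eigenInclusionProb (hpos : 0 < ∑ T ∈ Finset.univ.powersetCard k, ∏ a ∈ T, v a) :
    ∑ i, eigenInclusionProb k v i = k := by
  unfold eigenInclusionProb
  rw [← Finset.sum_div, div_eq_iff hpos.ne']
  simp_rw [Finset.sum_filter]
  rw [Finset.sum_comm, Finset.mul_sum]
  refine Finset.sum_congr rfl fun T hT => ?_
  rw [← Finset.sum_filter, Finset.filter_univ_mem, Finset.sum_const,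
    (Finset.mem_powersetCard.mp hT).2, nsmul_eq_mul]

omit [DecidableEq ι] in
lemma sum_powersetCard_prod_pos (hv : ∀ i, 0 ≤ v i)
    (hk : k ≤ Fintype.card {i // v i ≠ 0}) :
    0 < ∑ T ∈ Finset.univ.powersetCard k, ∏ a ∈ T, v a := by
  rw [Fintype.card_subtype] at hk
  obtain ⟨T, hT, hTk⟩ := Finset.exists_subset_card_eq hk
  refine Finset.sum_pos' (fun _ _ => Finset.prod_nonneg fun a _ => hv a)
    ⟨T, Finset.mem_powersetCard.mpr ⟨Finset.subset_univ _, hTk⟩, Finset.prod_pos fun a ha => ?_⟩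
  exact (hv a).lt_of_ne' (Finset.mem_filter.mp (hT ha)).2

end EigenvectorInclusion

/-! ### Marginals of a `k`-DPP. -/

section KDPP

open Matrix

variable {m k : ℕ} {L : Matrix (Fin m) (Fin m) ℝ}

lemma kDPPWeight_nonneg (hL : L.PosSemidef) (S : Finset (Fin m)) : 0 ≤ kDPPWeight k L S := by
  unfold kDPPWeight
  split_ifs
  · exact (hL.submatrix _).det_nonneg
  · exact le_rfl

lemma sum_filter_kDPPWeight (p : Finset (Fin m) → Prop) [DecidablePred p] :
    ∑ S with p S, kDPPWeight k L S = ∑ S ∈ Finset.univ.powersetCard k with p S,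
      (L.submatrix (Subtype.val : S → Fin m) (Subtype.val : S → Fin m)).det := by
  unfold kDPPWeight
  rw [← Finset.sum_filter, Finset.filter_filter]
  refine Finset.sum_congr ?_ fun S _ => rfl
  ext S
  simp [Finset.mem_powersetCard, and_comm]

lemma sum_kDPPWeight :
    ∑ S, kDPPWeight k L S = ∑ S ∈ Finset.univ.powersetCard k,
      (L.submatrix (Subtype.val : S → Fin m) (Subtype.val : S → Fin m)).det := by
  simpa using sum_filter_kDPPWeight (k := k) (L := L) fun _ => True

lemma kDPP_apply (hL : L.PosSemidef) (p : Finset (Fin m) → Prop) [DecidablePred p] :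
    kDPP k L {S | p S} =
      ENNReal.ofReal ((∑ S with p S, kDPPWeight k L S) / ∑ S, kDPPWeight k L S) := by
  have h0 : ∀ S, 0 ≤ kDPPWeight k L S / ∑ T, kDPPWeight k L T := fun S =>
    div_nonneg (kDPPWeight_nonneg hL S) (Finset.sum_nonneg fun T _ => kDPPWeight_nonneg hL T)
  rw [Finset.sum_div, ENNReal.ofReal_sum_of_nonneg fun S _ => h0 S, Finset.sum_filter]
  unfold kDPP
  rw [Measure.finsetSum_apply]
  refine Finset.sum_congr rfl fun S _ => ?_
  rw [Measure.smul_apply, Measure.dirac_apply, smul_eq_mul, Set.indicator_apply]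
  simp only [Set.mem_ofPred_eq, Pi.one_apply, mul_ite, mul_one, mul_zero]

lemma isProbabilityMeasure_kDPP (hL : L.PosSemidef) (h : 0 < ∑ S, kDPPWeight k L S) :
    IsProbabilityMeasure (kDPP k L) := by
  refine ⟨?_⟩
  have := kDPP_apply (k := k) hL fun _ => True
  simpa [div_self h.ne'] using this

/-- The marginals of a `k`-DPP in terms of a spectral decomposition of its ensemble matrix. -/
lemma kDPP_real_mem {U : Matrix (Fin m) (Fin m) ℝ} (hU : U * Uᵀ = 1) {v : Fin m → ℝ}
    (hL : (U * diagonal v * Uᵀ).PosSemidef) (j : Fin m) :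
    (kDPP k (U * diagonal v * Uᵀ)).real {S | j ∈ S} =
      ∑ i, eigenInclusionProb k v i * U j i ^ 2 := by
  have hsum := sum_kDPPWeight (k := k) (L := U * diagonal v * Uᵀ)
  rw [sum_principal_minors_conj_diagonal hU] at hsum
  have hnot := sum_filter_kDPPWeight (k := k) (L := U * diagonal v * Uᵀ) fun S => j ∉ S
  rw [sum_principal_minors_conj_diagonal_of_notMem hU] at hnot
  have hsplit := Finset.sum_filter_add_sum_filter_not Finset.univ (fun S => j ∈ S)
    (kDPPWeight k (U * diagonal v * Uᵀ))
  have hrow : ∑ i, U j i ^ 2 = 1 := by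
    have := congrFun (congrFun hU j) j
    rw [mul_apply, one_apply_eq] at this
    simpa [sq] using this
  -- Pass to the complementary event; since row `j` of `U` is a unit vector, the total weight also
  -- splits as an average with weights `U j i ^ 2`.
  have hmem : ∑ S with j ∈ S, kDPPWeight k (U * diagonal v * Uᵀ) S =
      ∑ i, U j i ^ 2 * ∑ T ∈ Finset.univ.powersetCard k with i ∈ T, ∏ a ∈ T, v a := by
    have h : ∑ S with j ∈ S, kDPPWeight k (U * diagonal v * Uᵀ) S =
        (∑ i, U j i ^ 2) * (∑ T ∈ Finset.univ.powersetCard k, ∏ a ∈ T, v a) -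
          ∑ i, U j i ^ 2 * ∑ T ∈ Finset.univ.powersetCard k with i ∉ T, ∏ a ∈ T, v a := by
      rw [hrow, one_mul, ← hsum, ← hnot]
      linarith
    rw [h, Finset.sum_mul, ← Finset.sum_sub_distrib]
    refine Finset.sum_congr rfl fun i _ => ?_
    rw [← Finset.sum_filter_add_sum_filter_not (Finset.univ.powersetCard k) (fun T => i ∈ T)]
    ring
  rw [measureReal_def, kDPP_apply hL, ENNReal.toReal_ofReal (div_nonneg
    (Finset.sum_nonneg fun S _ => kDPPWeight_nonneg hL S)
    (Finset.sum_nonneg fun S _ => kDPPWeight_nonneg hL S)), hmem, hsum, Finset.sum_div]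
  refine Finset.sum_congr rfl fun i _ => ?_
  unfold eigenInclusionProb
  ring

end KDPP

/-! ### Hadamard matrices and the transformed spectral decomposition. -/

section Hadamard

open Matrix

lemma hadamardMatrix_mul_transpose (l : ℕ) :
    hadamardMatrix l * (hadamardMatrix l)ᵀ = (2 : ℝ) ^ l • 1 := by
  induction l with
  | zero =>
    ext i j
    have hij : i = j := Fin.ext (by have := i.2; have := j.2; lia)
    simp [hadamardMatrix, mul_apply, hij]
  | succ l ih =>
    simp only [hadamardMatrix, reindex_apply, transpose_submatrix, submatrix_mul_equiv,
      fromBlocks_transpose, fromBlocks_multiply, transpose_neg, ih]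
    have hblocks : fromBlocks ((2 : ℝ) ^ l • 1 + (2 : ℝ) ^ l • 1)
        ((2 : ℝ) ^ l • 1 + hadamardMatrix l * -(hadamardMatrix l)ᵀ)
        ((2 : ℝ) ^ l • 1 + -hadamardMatrix l * (hadamardMatrix l)ᵀ)
        ((2 : ℝ) ^ l • 1 + -hadamardMatrix l * -(hadamardMatrix l)ᵀ) = (2 : ℝ) ^ (l + 1) • 1 := by
      rw [← fromBlocks_one, fromBlocks_smul, Matrix.mul_neg, Matrix.neg_mul, Matrix.neg_mul,
        Matrix.mul_neg, ih, pow_succ]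
      congr 1 <;> module
    rw [hblocks]
    ext i j
    simp [one_apply]

lemma hadamardMatrix_sq_apply (l : ℕ) (i j : Fin (2 ^ l)) : hadamardMatrix l i j ^ 2 = 1 := by
  induction l with
  | zero => simp [hadamardMatrix]
  | succ l ih =>
    simp only [hadamardMatrix, reindex_apply, submatrix_apply]
    generalize (Equiv.symm _) i = a
    generalize (Equiv.symm _) j = b
    rcases a with a | a <;> rcases b with b | b <;> simp [ih]

variable {l n k : ℕ}

/-- A sign-flipped Hadamard transform preserves orthogonality. -/
lemma hadamardTransform_mul_transpose {d : Fin (2 ^ l) → ℝ} (hd : ∀ a, d a = 1 ∨ d a = -1)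
    {V : Matrix (Fin (2 ^ l)) (Fin (2 ^ l)) ℝ} (hV : V * Vᵀ = 1) :
    hadamardTransform d V * (hadamardTransform d V)ᵀ = 1 := by
  have hdd : (diagonal d : Matrix (Fin (2 ^ l)) (Fin (2 ^ l)) ℝ) * diagonal d = 1 := by
    rw [diagonal_mul_diagonal, ← diagonal_one]
    congr 1
    ext a
    rcases hd a with h | h <;> simp [h]
  have hsq : (1 / √((2 : ℝ) ^ l)) * (1 / √((2 : ℝ) ^ l)) * 2 ^ l = 1 := by
    rw [div_mul_div_comm, one_mul, Real.mul_self_sqrt (by positivity)]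
    exact one_div_mul_cancel (by positivity)
  unfold hadamardTransform
  rw [transpose_smul, smul_mul_smul_comm, transpose_mul, transpose_mul, diagonal_transpose]
  calc _ = (1 / √((2 : ℝ) ^ l) * (1 / √((2 : ℝ) ^ l))) •
        (hadamardMatrix l * (diagonal d * (V * Vᵀ) * diagonal d) * (hadamardMatrix l)ᵀ) := by
        simp only [Matrix.mul_assoc]
    _ = 1 := by
        rw [hV, Matrix.mul_one, hdd, Matrix.mul_one, hadamardMatrix_mul_transpose, smul_smul, hsq,
          one_smul]

lemma hadamardTransform_eq_mul (d : Fin (2 ^ l) → ℝ) (A : Matrix (Fin (2 ^ l)) (Fin n) ℝ) :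
    hadamardTransform d A =
      hadamardTransform d (1 : Matrix (Fin (2 ^ l)) (Fin (2 ^ l)) ℝ) * A := by
  unfold hadamardTransform
  rw [Matrix.smul_mul, Matrix.mul_one]

lemma hadamardTransform_apply (d : Fin (2 ^ l) → ℝ) (A : Matrix (Fin (2 ^ l)) (Fin n) ℝ)
    (j : Fin (2 ^ l)) (i : Fin n) :
    hadamardTransform d A j i =
      1 / √((2 : ℝ) ^ l) * ∑ a, hadamardMatrix l j a * A a i * d a := by
  unfold hadamardTransform
  rw [Matrix.smul_apply, mul_apply, smul_eq_mul]
  congr 1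
  refine Finset.sum_congr rfl fun a _ => ?_
  rw [mul_diagonal]
  ring

/-- The ensemble matrix after a sign-flipped Hadamard transform has, for any signs, the same
eigenvalues, and eigenvectors that are transformed accordingly. -/
lemma exists_spectral_decomposition (A : Matrix (Fin (2 ^ l)) (Fin n) ℝ) :
    ∃ (V : Matrix (Fin (2 ^ l)) (Fin (2 ^ l)) ℝ) (v : Fin (2 ^ l) → ℝ),
      V * Vᵀ = 1 ∧ (∀ i, 0 ≤ v i) ∧ A.rank = Fintype.card {i // v i ≠ 0} ∧
      ∀ d, hadamardTransform d A * (hadamardTransform d A)ᵀ =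
        hadamardTransform d V * diagonal v * (hadamardTransform d V)ᵀ := by
  have hA : (A * Aᵀ).PosSemidef := by
    simpa using posSemidef_self_mul_conjTranspose A
  have hspec := hA.isHermitian.spectral_theorem
  rw [Unitary.conjStarAlgAut_apply] at hspec
  set V : Matrix (Fin (2 ^ l)) (Fin (2 ^ l)) ℝ := ↑hA.isHermitian.eigenvectorUnitary with hV
  have hstar : (star (hA.isHermitian.eigenvectorUnitary : Matrix (Fin (2 ^ l)) (Fin (2 ^ l)) ℝ))
      = Vᵀ := by
    rw [star_eq_conjTranspose, conjTranspose_eq_transpose_of_trivial]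
  refine ⟨V, hA.isHermitian.eigenvalues, ?_, hA.eigenvalues_nonneg, ?_, fun d => ?_⟩
  · rw [← hstar]
    exact Unitary.coe_mul_star_self _
  · rw [← rank_self_mul_transpose, hA.isHermitian.rank_eq_card_non_zero_eigs]
  · rw [hadamardTransform_eq_mul d A, hadamardTransform_eq_mul d V, transpose_mul, transpose_mul]
    have : A * Aᵀ = V * diagonal hA.isHermitian.eigenvalues * Vᵀ := by
      rw [← hstar]; exact hspec
    set Q : Matrix (Fin (2 ^ l)) (Fin (2 ^ l)) ℝ := hadamardTransform d 1
    calc _ = Q * (A * Aᵀ) * Qᵀ := by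
          simp only [Matrix.mul_assoc]
      _ = Q * (V * diagonal hA.isHermitian.eigenvalues * Vᵀ) * Qᵀ :=
          congrArg (fun M => Q * M * Qᵀ) this
      _ = _ := by simp only [Matrix.mul_assoc]

lemma posSemidef_mul_transpose (B : Matrix (Fin (2 ^ l)) (Fin n) ℝ) : (B * Bᵀ).PosSemidef := by
  simpa using posSemidef_self_mul_conjTranspose B

end Hadamard

/-! ### Concentration of the marginals. -/

section Marginals

open Matrix Real

variable {l n k : ℕ} {A : Matrix (Fin (2 ^ l)) (Fin n) ℝ}

lemma isProbabilityMeasure_kDPP_hadamardTransform (hk : k ≤ A.rank) {d : Fin (2 ^ l) → ℝ}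
    (hd : ∀ a, d a = 1 ∨ d a = -1) :
    IsProbabilityMeasure (kDPP k (hadamardTransform d A * (hadamardTransform d A)ᵀ)) := by
  obtain ⟨V, v, hV, hv0, hrank, hdec⟩ := exists_spectral_decomposition A
  refine isProbabilityMeasure_kDPP (posSemidef_mul_transpose _) ?_
  rw [sum_kDPPWeight, hdec,
    sum_principal_minors_conj_diagonal (hadamardTransform_mul_transpose hd hV)]
  exact sum_powersetCard_prod_pos hv0 (hrank ▸ hk)

/-- `V` and `w` are chosen before `d` and `j`, so the marginals are fixed quadratic forms in the
random signs. -/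
lemma exists_marginalAfterTransform_eq (hk : k ≤ A.rank) :
    ∃ (V : Matrix (Fin (2 ^ l)) (Fin (2 ^ l)) ℝ) (w : Fin (2 ^ l) → ℝ),
      Vᵀ * V = 1 ∧ (∀ i, 0 ≤ w i) ∧ (∀ i, w i ≤ 1) ∧ ∑ i, w i = k ∧
      ∀ d, (∀ a, d a = 1 ∨ d a = -1) → ∀ j, marginalAfterTransform k A d j =
        (∑ i, w i * (∑ a, hadamardMatrix l j a * V a i * d a) ^ 2) / 2 ^ l := by
  obtain ⟨V, v, hV, hv0, hrank, hdec⟩ := exists_spectral_decomposition A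
  have hpos := sum_powersetCard_prod_pos hv0 (hrank ▸ hk)
  refine ⟨V, eigenInclusionProb k v, mul_eq_one_comm.mp hV, eigenInclusionProb_nonneg hv0,
    eigenInclusionProb_le_one hv0, sum_eigenInclusionProb hpos, fun d hd j => ?_⟩
  unfold marginalAfterTransform
  rw [hdec, kDPP_real_mem (hadamardTransform_mul_transpose hd hV)
    (hdec d ▸ posSemidef_mul_transpose _), Finset.sum_div]
  refine Finset.sum_congr rfl fun i _ => ?_
  rw [hadamardTransform_apply, mul_pow, div_pow, one_pow, sq_sqrt (by positivity)]
  ring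

variable {Ω : Type*} [MeasurableSpace Ω] {P : Measure Ω} [IsProbabilityMeasure P]
  {d : Fin (2 ^ l) → Ω → ℝ}

lemma one_sub_le_prob_marginalAfterTransform_le (hk : k ≤ A.rank) (hd : IsRademacherVector P d)
    {δ : ℝ} (hδ0 : 0 < δ) (hδ1 : δ < 1) :
    1 - δ ≤ P.real {ω | ∀ j, marginalAfterTransform k A (fun i => d i ω) j ≤
      (√((k : ℝ) / 2 ^ l) + √(8 * log (2 ^ l / δ) / 2 ^ l)) ^ 2} := by
  obtain ⟨V, w, hV, hw0, hw1, hwk, hmarg⟩ := exists_marginalAfterTransform_eq hk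
  set x : ℝ := 2 ^ l with hx
  have hx1 : 1 ≤ x := one_le_pow₀ (by norm_num)
  have hx0 : 0 < x := by linarith
  have hr1 : 1 ≤ x / δ := by rw [le_div_iff₀ hδ0]; linarith
  have hlog : 0 ≤ log (x / δ) := log_nonneg hr1
  set t := √(8 * log (x / δ)) with ht
  have ht0 : 0 ≤ t := sqrt_nonneg _
  have ht2 : t ^ 2 = 8 * log (x / δ) := sq_sqrt (by positivity)
  have hthreshold : (√((k : ℝ) / x) + √(8 * log (x / δ) / x)) ^ 2 = (√k + t) ^ 2 / x := by
    rw [sqrt_div (Nat.cast_nonneg k), sqrt_div (by positivity), ← add_div, div_pow, sq_sqrt hx0.le]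
  set bad : Fin (2 ^ l) → Set Ω := fun j =>
    {ω | (√k + t) ^ 2 < ∑ i, w i * (∑ a, hadamardMatrix l j a * V a i * d a ω) ^ 2} with hbad
  have hm := hd.measurable
  have hbad_meas : ∀ j, MeasurableSet (bad j) := fun j =>
    measurableSet_lt measurable_const (by fun_prop)
  -- The left side is `(δ / x) ^ 4`, so the constant `8` leaves slack.
  have hexp : exp (-t ^ 2 / 2) ≤ δ / x := by
    have : exp (-log (x / δ)) = δ / x := by
      rw [exp_neg, exp_log (by positivity), inv_div]
    rw [← this, exp_le_exp, ht2]
    linarith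
  have hbad_prob : ∀ j, P.real (bad j) ≤ δ / x := by
    intro j
    have h := hd.measure_quadratic_gt_le (v := fun i a => hadamardMatrix l j a * V a i)
      (fun i i' => by
        have := congrFun (congrFun hV i) i'
        rw [mul_apply, one_apply] at this
        rw [← this]
        refine Finset.sum_congr rfl fun a _ => ?_
        rw [transpose_apply]
        linear_combination V a i * V a i' * hadamardMatrix_sq_apply l j a) hw0 hw1 ht0
    rw [hwk] at h
    exact (ENNReal.toReal_le_of_le_ofReal (exp_pos _).le h).trans hexp
  have hunion : P.real (⋃ j, bad j) ≤ δ := by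
    refine (measureReal_iUnion_fintype_le bad).trans
      ((Finset.sum_le_sum fun j _ => hbad_prob j).trans (le_of_eq ?_))
    rw [Finset.sum_const, Finset.card_univ, Fintype.card_fin, nsmul_eq_mul]
    push_cast
    rw [← hx]
    field_simp
  have hcompl : P.real (⋃ j, bad j)ᶜ = 1 - P.real (⋃ j, bad j) :=
    probReal_compl_eq_one_sub (MeasurableSet.iUnion hbad_meas)
  have hle : P.real (⋃ j, bad j)ᶜ ≤ P.real {ω | ∀ j, marginalAfterTransform k A
      (fun i => d i ω) j ≤ (√((k : ℝ) / x) + √(8 * log (x / δ) / x)) ^ 2} := by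
    refine ENNReal.toReal_mono (measure_ne_top _ _) (measure_mono_ae ?_)
    filter_upwards [hd.ae_eq_one_or] with ω hω hgood
    intro j
    have hj : ω ∉ bad j := fun h => hgood (Set.mem_iUnion.mpr ⟨j, h⟩)
    rw [hmarg _ hω, hthreshold]
    exact div_le_div_of_nonneg_right (not_lt.mp hj) hx0.le
  linarith

/-- By `(a + b)² ≤ 2 (a² + b²)` the numerator is at most `2 k + 16 log 100 + 16 log x`; `1 ≤ k`
absorbs the constant and `log x ≤ k` the last term. -/
lemma isotropy_threshold_le {k : ℕ} {x : ℝ} (hx : 1 ≤ x) (hk : 1 ≤ k) (hlog : log x ≤ k) :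
    (√((k : ℝ) / x) + √(8 * log (x / 0.01) / x)) ^ 2 ≤ (18 + 16 * log 100) * k / x := by
  have hx0 : 0 < x := by linarith
  have hk' : (1 : ℝ) ≤ k := by exact_mod_cast hk
  have h100 : 0 ≤ log 100 := log_nonneg (by norm_num)
  have hsplit : log (x / 0.01) = log 100 + log x := by
    rw [← log_mul (by norm_num) hx0.ne']
    congr 1
    ring
  have hnn : 0 ≤ 8 * log (x / 0.01) / x := by
    rw [hsplit]
    have := log_nonneg hx
    positivity
  calc _ ≤ 2 * (√((k : ℝ) / x) ^ 2 + √(8 * log (x / 0.01) / x) ^ 2) := add_sq_le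
    _ = (2 * k + 16 * (log 100 + log x)) / x := by
        rw [sq_sqrt (by positivity), sq_sqrt hnn, hsplit]
        ring
    _ ≤ _ := by
        refine div_le_div_of_nonneg_right ?_ hx0.le
        nlinarith

lemma prob_marginalAfterTransform_isotropic (hk : k ≤ A.rank) (hd : IsRademacherVector P d)
    (hlog : log (2 ^ l) ≤ k) :
    0.99 ≤ P.real {ω | ∀ j, marginalAfterTransform k A (fun i => d i ω) j ≤
      (18 + 16 * log 100) * k / 2 ^ l} := by
  rcases Nat.eq_zero_or_pos k with rfl | hpos
  -- For `k = 0` the threshold is `0`; the weights sum to `0`, so all marginals vanish almost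
  -- surely.
  · obtain ⟨V, w, -, hw0, -, hwk, hmarg⟩ := exists_marginalAfterTransform_eq hk
    have hw : ∀ i, w i = 0 := fun i =>
      (Finset.sum_eq_zero_iff_of_nonneg fun i _ => hw0 i).mp (by simpa using hwk) i
        (Finset.mem_univ i)
    have h1 : P.real {ω | ∀ j, marginalAfterTransform 0 A (fun i => d i ω) j ≤
        (18 + 16 * log 100) * (0 : ℕ) / 2 ^ l} = 1 := by
      rw [measureReal_def, ENNReal.toReal_eq_one_iff, ← measure_univ (μ := P)]
      refine measure_congr (Filter.eventuallyEq_set.mpr ?_)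
      filter_upwards [hd.ae_eq_one_or] with ω hω
      simp [hmarg _ hω, hw]
    rw [h1]
    norm_num
  · have h := one_sub_le_prob_marginalAfterTransform_le hk hd (δ := 0.01) (by norm_num)
      (by norm_num)
    refine le_trans (by norm_num) (h.trans (measureReal_mono fun ω hω j => (hω j).trans ?_))
    exact isotropy_threshold_le (one_le_pow₀ (by norm_num)) hpos hlog

end Marginals

theorem lemma5p4 :
    ∃ c₀ : ℝ, 0 < c₀ ∧
      ∀ (Ω : Type*) [MeasurableSpace Ω] (P : Measure Ω) [IsProbabilityMeasure P]
        (l n k : ℕ) (A : Matrix (Fin (2 ^ l)) (Fin n) ℝ) (_ : k ≤ A.rank)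
        (d : Fin (2 ^ l) → Ω → ℝ) (_ : IsRademacherVector P d),
        -- the distribution `k`-DPP is well defined
        (∀ᵐ ω ∂P, IsProbabilityMeasure
          (kDPP k (hadamardTransform (fun i => d i ω) A *
            (hadamardTransform (fun i => d i ω) A).transpose))) ∧
        -- the bound on the marginals
        (∀ δ : ℝ, 0 < δ → δ < 1 →
          1 - δ ≤ P.real {ω | ∀ j, marginalAfterTransform k A (fun i => d i ω) j ≤
            (√((k : ℝ) / 2 ^ l) + √(8 * Real.log (2 ^ l / δ) / 2 ^ l)) ^ 2}) ∧
        -- approximate isotropy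
        (Real.log (2 ^ l) ≤ k →
          0.99 ≤ P.real {ω | ∀ j, marginalAfterTransform k A (fun i => d i ω) j ≤
            c₀ * k / 2 ^ l}) := by
  refine ⟨18 + 16 * Real.log 100, by positivity, ?_⟩
  intro Ω _ P _ l n k A hk d hd
  refine ⟨?_, fun δ hδ0 hδ1 => one_sub_le_prob_marginalAfterTransform_le hk hd hδ0 hδ1,
    prob_marginalAfterTransform_isotropic hk hd⟩
  filter_upwards [hd.ae_eq_one_or] with ω hω
  exact isProbabilityMeasure_kDPP_hadamardTransform hk hω
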